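/- Let $q_1\in\mathbb R^3\setminus\{0\}$, let $S_0,S_1:\mathbb R^3\to\mathbb C$ be measurable, and for every $\varepsilon>0$ let $\alpha_\varepsilon>0$, with $\alpha_\varepsilon\to0$ as $\varepsilon\to0^+$. For $\varepsilon>0$ let $u^\varepsilon\in L^2(\mathbb R^3)$ be the solution, in the sense of distributions, of $$-i\frac{\alpha_\varepsilon}{\varepsilon}u^\varepsilon+\Delta u^\varepsilon+\frac1{\varepsilon^2}u^\varepsilon=\frac1{\varepsilon^3}S_0\Big(\frac x\varepsilon\Big)+\frac1{\varepsilon^3}S_1\Big(\frac{x-q_1}\varepsilon\Big),\qquad x\in\mathbb R^3 .$$ Assume: (H1) there is $\gamma>0$ such that $\alpha_\varepsilon\ge\varepsilon^\gamma$ for all sufficiently small $\varepsilon>0$; (H2) $\|S_0\|_B<\infty$ and $\|S_1\|_B<\infty$, where $\|f\|_B=\sum_{j\ge-1}\big(2^{j+1}\int_{C(j)}|f|^2dx\big)^{1/2}$, $C(-1)=\{|x|<1\}$ and $C(j)=\{2^j\le|x|<2^{j+1}\}$ for $j\ge0$; (H3) $(1+|x|^2)^{N/2}S_0\in L^2(\mathbb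 R^3)$ and $(1+|x|^2)^{N/2}S_1\in L^2(\mathbb R^3)$ for some $N>\frac12+\frac{3\gamma}{\gamma+1}$, with $\gamma$ as in (H1). Let $$W^\varepsilon(x,\xi)=\frac1{(2\pi)^3}\int_{\mathbb R^3}e^{-iy\cdot\xi}\,u^\varepsilon\big(x+\tfrac\varepsilon2y\big)\,\overline{u^\varepsilon\big(x-\tfrac\varepsilon2y\big)}\,dy$$ be the Wigner transform of $u^\varepsilon$, and let $\mu$ be a Wigner measure of $(u^\varepsilon)$, that is, a nonnegative Radon measure on $\mathbb R^3_x\times\mathbb R^3_\xi$ such that, for some sequence $\varepsilon_n>0$ with $\varepsilon_n\to0$, $$\lim_{n\to\infty}\int_{\mathbb R^6}W^{\varepsilon_n}(x,\xi)\,\varphi(x,\xi)\,dx\,d\xi=\int_{\mathbb R^6}\varphi\,d\mu\qquad\text{for all }\varphi\in C_c^\infty(\mathbb R^6).$$ Then $$\operatorname{supp}(\mu)\subset\{(x,\xi)\in\mathbb R^6:\ |\xi|^2=1\}.$$ -/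

import Mathlib

open MeasureTheory Filter Topology
open scoped ENNReal ContDiff

noncomputable section

namespace HelmholtzWigner

/-- The physical space `ℝ³` with its Euclidean norm. -/
abbrev R3 : Type := EuclideanSpace ℝ (Fin 3)

/-- The dyadic rings: `dyadicRing 0` is the unit ball `C(-1)` and
`dyadicRing (j + 1)` is `C(j) = {x | 2 ^ j ≤ |x| < 2 ^ (j + 1)}`, for `j ≥ 0`. -/
def dyadicRing : ℕ → Set R3
  | 0 => {x | ‖x‖ < 1}
  | j + 1 => {x | (2 : ℝ) ^ j ≤ ‖x‖ ∧ ‖x‖ < (2 : ℝ) ^ (j + 1)}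

/-- The Agmon–Hörmander norm `‖f‖_B = ∑_{j ≥ -1} (2 ^ (j + 1) ∫_{C(j)} |f|²) ^ (1/2)`,
with values in `[0, ∞]`; the index `j` of the code is `j + 1` in the usual numbering. -/
def normB (f : R3 → ℂ) : ℝ≥0∞ :=
  ∑' j : ℕ, ((2 : ℝ≥0∞) ^ j * ∫⁻ x in dyadicRing j, ‖f x‖ₑ ^ 2) ^ (1 / 2 : ℝ)

/-- Membership in the Agmon–Hörmander space `B`. -/
def MemB (f : R3 → ℂ) : Prop :=
  AEStronglyMeasurable f volume ∧ normB f < ⊤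

/-- `⟨x⟩ ^ N f ∈ L²(ℝ³)`, where `⟨x⟩ = (1 + |x|²) ^ (1/2)`. -/
def MemWeightedL2 (N : ℝ) (f : R3 → ℂ) : Prop :=
  MemLp (fun x : R3 => Real.sqrt (1 + ‖x‖ ^ 2) ^ N • f x) 2 volume

/-- The source `S^ε(x) = ε⁻³ S₀(x / ε) + ε⁻³ S₁((x - q₁) / ε)`. -/
def source (S₀ S₁ : R3 → ℂ) (q₁ : R3) (ε : ℝ) (x : R3) : ℂ :=
  ((ε ^ 3)⁻¹ : ℝ) • S₀ (ε⁻¹ • x) + ((ε ^ 3)⁻¹ : ℝ) • S₁ (ε⁻¹ • (x - q₁))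

/-- `u ∈ L²(ℝ³)` solves `-i (a / ε) u + Δ u + ε⁻² u = f` in the sense of distributions. -/
def IsHelmholtzSolution (a ε : ℝ) (f u : R3 → ℂ) : Prop :=
  MemLp u 2 volume ∧
    ∀ φ : R3 → ℂ, ContDiff ℝ ∞ φ → HasCompactSupport φ →
      ∫ x, u x * (-Complex.I * ((a / ε : ℝ) : ℂ) * φ x + Laplacian.laplacian φ x
          + (((ε ^ 2)⁻¹ : ℝ) : ℂ) * φ x) = ∫ x, f x * φ x

/-- The Wigner transform
`W^ε(u)(x, ξ) = (2π)⁻³ ∫ e^{-i y·ξ} u(x + ε y / 2) conj (u(x - ε y / 2)) dy`.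
For `u ∈ L²` and `ε > 0` the integral converges absolutely at every `(x, ξ)`. -/
def wigner (ε : ℝ) (u : R3 → ℂ) (p : R3 × R3) : ℂ :=
  (((2 * Real.pi) ^ 3)⁻¹ : ℝ) •
    ∫ y : R3, Complex.exp (-Complex.I * ((inner ℝ y p.2 : ℝ) : ℂ)) *
      (u (p.1 + (ε / 2) • y) * star (u (p.1 - (ε / 2) • y)))

/-- `μ` is a Wigner measure of the family `(u^ε)` as `ε → 0⁺`: it is a (nonnegative) Radon measure
on the phase space `ℝ³ × ℝ³`, and along some sequence `ε_n → 0⁺` the Wigner transforms converge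
to `μ` when tested against smooth compactly supported functions. -/
def IsWignerMeasure (u : ℝ → R3 → ℂ) (μ : Measure (R3 × R3)) : Prop :=
  IsLocallyFiniteMeasure μ ∧
    ∃ e : ℕ → ℝ, (∀ n, 0 < e n) ∧ Tendsto e atTop (𝓝 0) ∧
      ∀ φ : R3 × R3 → ℂ, ContDiff ℝ ∞ φ → HasCompactSupport φ →
        Tendsto (fun n => ∫ p, wigner (e n) (u (e n)) p * φ p) atTop (𝓝 (∫ p, φ p ∂μ))

end HelmholtzWigner

end

/-!
# Wigner measures of the Helmholtz equation with two concentrated sources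

A Wigner measure of `u^ε` is carried by the unit sphere because, away from it, the operator
`ε² Δ + 1 - i α ε` is elliptic at the semiclassical scale: there `u^ε` is no larger than `ε²` times
the source `f^ε`, whose squared `L²` norm is `O(ε⁻³)`, so that the quadratic quantity
`∫ W^ε a ⊗ b` is of order `ε⁴ ε⁻³ = ε`. No uniform bound on `u^ε` is needed, only a polynomial one.

In detail, all quantities are expressed by the forms
`J(u, v) = ∬ h ((p - z) / δ) a ((p + z) / 2) u(p) conj (v(z)) dp dz` (`pairForm`).

* For `h = 𝓕 b` and `δ = 2 π ε` the form `J(u, u)` is, up to a factor `ε⁻³`, the Wigner transform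
  tested against `a ⊗ b` (`integral_wigner_mul`). Tensor products suffice to test a measure
  (`notMem_support_of_integral_eq_zero`).
* Testing the equation against `p ↦ h ((p - z) / δ) a ((p + z) / 2)`, for frozen `z`, gives the
  Wigner equation (`wigner_equation`). It says that `J(u, v)` with kernel `𝓕 ((1 - |ξ|²) g)` equals
  `ε² J(f, v)` with kernel `𝓕 g`, up to forms `J(u, v)` that carry a factor `ε` and whose kernels are
  again transforms of functions with support in that of `g`.
* If `b` is supported off the unit sphere, `g = b / (1 - |ξ|²)` is again such a function, so every
  use of the Wigner equation gains a power of `ε`, until the order of `ε² J(f, v)` is reached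
  (`HasOrder.of_source`). Applied once in each variable, this yields `J(u, u) = O(ε⁴)`.
* The bootstrap starts from the energy estimate `‖u‖ ≤ (ε / α) ‖f‖` (`energy_estimate`), which is
  polynomial in `1 / ε` since `α ≥ ε ^ γ`. It is the imaginary part of the Wigner equation with
  `v = u`, for a cutoff `a → 1` and an approximate identity `h`.
-/

noncomputable section

namespace HelmholtzWigner

open SchwartzMap LineDeriv Laplacian FourierTransform

/-! ### The sesquilinear forms and their bounds -/

/-- The form `J(u, v) = ∬ h ((p - z) / δ) a ((p + z) / 2) u(p) conj (v(z)) dp dz`. The midpoint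
variable of `a` is the position in the Wigner transform, and `h` stands for the Fourier transform
of the test function in the frequency variable. -/
def pairForm (δ : ℝ) (u v a h : R3 → ℂ) : ℂ :=
  ∫ p : R3 × R3, h (δ⁻¹ • (p.1 - p.2)) * a ((2 : ℝ)⁻¹ • (p.1 + p.2)) * (u p.1 * star (v p.2))

lemma integral_swap {F : Type*} [NormedAddCommGroup F] [NormedSpace ℝ F] (g : R3 × R3 → F) :
    ∫ p : R3 × R3, g p.swap = ∫ p : R3 × R3, g p :=
  integral_prod_swap g

lemma integrable_sq_norm {u : R3 → ℂ} (hu : MemLp u 2 volume) :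
    Integrable (fun x => ‖u x‖ ^ 2) := by
  simpa using hu.integrable_norm_pow (p := 2) two_ne_zero

lemma integrable_dilation_norm {h : R3 → ℂ} (hh : Integrable h) {δ : ℝ} (hδ : 0 < δ) :
    Integrable (fun y => ‖h (δ⁻¹ • y)‖) :=
  (hh.comp_smul (inv_ne_zero hδ.ne')).norm

lemma integral_dilation_norm (h : R3 → ℂ) {δ : ℝ} (hδ : 0 < δ) :
    ∫ y, ‖h (δ⁻¹ • y)‖ = δ ^ 3 * ∫ y, ‖h y‖ := by
  have := Measure.integral_comp_inv_smul (volume : Measure R3) (fun y => ‖h y‖) δ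
  simpa [abs_of_pos hδ] using this

lemma integrable_kernel_snd {h : R3 → ℂ} (hh : Integrable h) {δ : ℝ} (hδ : 0 < δ)
    {v : R3 → ℂ} (hv : MemLp v 2 volume) :
    Integrable (fun p : R3 × R3 => ‖v p.2‖ ^ 2 * ‖h (δ⁻¹ • (p.1 - p.2))‖) := by
  exact (integrable_sq_norm hv).convolution_integrand (ContinuousLinearMap.mul ℝ ℝ)
    (integrable_dilation_norm hh hδ)

lemma integral_kernel_snd {h : R3 → ℂ} (hh : Integrable h) {δ : ℝ} (hδ : 0 < δ)
    {v : R3 → ℂ} (hv : MemLp v 2 volume) :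
    ∫ p : R3 × R3, ‖v p.2‖ ^ 2 * ‖h (δ⁻¹ • (p.1 - p.2))‖ =
      (∫ z, ‖v z‖ ^ 2) * (δ ^ 3 * ∫ y, ‖h y‖) := by
  have := integral_convolution (ContinuousLinearMap.mul ℝ ℝ) (integrable_sq_norm hv)
    (integrable_dilation_norm hh hδ)
  rw [← integral_dilation_norm h hδ, ← ContinuousLinearMap.mul_apply' ℝ ℝ, ← this]
  exact integral_prod _ (integrable_kernel_snd hh hδ hv)

lemma integrable_kernel_fst {h : R3 → ℂ} (hh : Integrable h) {δ : ℝ} (hδ : 0 < δ)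
    {u : R3 → ℂ} (hu : MemLp u 2 volume) :
    Integrable (fun p : R3 × R3 => ‖u p.1‖ ^ 2 * ‖h (δ⁻¹ • (p.1 - p.2))‖) := by
  refine (integrable_kernel_snd hh.comp_neg hδ hu).swap.congr (.of_forall fun p => ?_)
  simp [← smul_neg]

lemma integral_kernel_fst {h : R3 → ℂ} (hh : Integrable h) {δ : ℝ} (hδ : 0 < δ)
    {u : R3 → ℂ} (hu : MemLp u 2 volume) :
    ∫ p : R3 × R3, ‖u p.1‖ ^ 2 * ‖h (δ⁻¹ • (p.1 - p.2))‖ =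
      (∫ z, ‖u z‖ ^ 2) * (δ ^ 3 * ∫ y, ‖h y‖) := by
  have h1 := integral_kernel_snd hh.comp_neg hδ hu
  rw [integral_neg_eq_self (fun y => ‖h y‖)] at h1
  rw [← h1, ← integral_swap]
  simp [← smul_neg]

lemma norm_pairForm_integrand_le {h a u v : R3 → ℂ} {A : ℝ} (hA : ∀ x, ‖a x‖ ≤ A) {t : ℝ}
    (ht : 0 < t) (δ : ℝ) (p : R3 × R3) :
    ‖h (δ⁻¹ • (p.1 - p.2)) * a ((2 : ℝ)⁻¹ • (p.1 + p.2)) * (u p.1 * star (v p.2))‖ ≤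
      A / 2 * (t * (‖u p.1‖ ^ 2 * ‖h (δ⁻¹ • (p.1 - p.2))‖)
        + t⁻¹ * (‖v p.2‖ ^ 2 * ‖h (δ⁻¹ • (p.1 - p.2))‖)) := by
  have h0 : 0 ≤ A := (norm_nonneg _).trans (hA 0)
  have h1 : ‖u p.1‖ * ‖v p.2‖ ≤ (t * ‖u p.1‖ ^ 2 + t⁻¹ * ‖v p.2‖ ^ 2) / 2 := by
    have h2 : (t * ‖u p.1‖ ^ 2 + t⁻¹ * ‖v p.2‖ ^ 2) / 2 - ‖u p.1‖ * ‖v p.2‖ =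
        t⁻¹ / 2 * (t * ‖u p.1‖ - ‖v p.2‖) ^ 2 := by field_simp; ring
    have : 0 ≤ t⁻¹ / 2 * (t * ‖u p.1‖ - ‖v p.2‖) ^ 2 := by positivity
    linarith
  rw [norm_mul, norm_mul, norm_mul, norm_star]
  calc _ ≤ ‖h (δ⁻¹ • (p.1 - p.2))‖ * A * ((t * ‖u p.1‖ ^ 2 + t⁻¹ * ‖v p.2‖ ^ 2) / 2) := by
        gcongr
        exact hA _
    _ = _ := by ring

lemma integrable_pairForm {h a u v : R3 → ℂ} (hh : Integrable h) (hhc : Continuous h)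
    (hac : Continuous a) {A : ℝ} (hA : ∀ x, ‖a x‖ ≤ A) {δ : ℝ} (hδ : 0 < δ)
    (hu : MemLp u 2 volume) (hv : MemLp v 2 volume) :
    Integrable (fun p : R3 × R3 =>
      h (δ⁻¹ • (p.1 - p.2)) * a ((2 : ℝ)⁻¹ • (p.1 + p.2)) * (u p.1 * star (v p.2))) := by
  refine Integrable.mono' ((((integrable_kernel_fst hh hδ hu).const_mul 1).add
    ((integrable_kernel_snd hh hδ hv).const_mul 1⁻¹)).const_mul (A / 2)) ?_
    (.of_forall fun p => norm_pairForm_integrand_le hA one_pos δ p)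
  have hu' : AEStronglyMeasurable (fun p : R3 × R3 => u p.1) := hu.1.comp_fst
  have hv' : AEStronglyMeasurable (fun p : R3 × R3 => v p.2) := hv.1.comp_snd
  refine AEStronglyMeasurable.mul (Continuous.aestronglyMeasurable (by fun_prop)) ?_
  exact hu'.mul hv'.star

/-- A Schur type bound. The weight `t` makes it homogeneous in `u` and `v` upon optimization. -/
lemma norm_pairForm_le {h a u v : R3 → ℂ} (hh : Integrable h)
    {A : ℝ} (hA : ∀ x, ‖a x‖ ≤ A) {δ : ℝ} (hδ : 0 < δ)
    (hu : MemLp u 2 volume) (hv : MemLp v 2 volume) {t : ℝ} (ht : 0 < t) :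
    ‖pairForm δ u v a h‖ ≤ A / 2 * (δ ^ 3 * ∫ y, ‖h y‖) *
      (t * (∫ x, ‖u x‖ ^ 2) + t⁻¹ * ∫ x, ‖v x‖ ^ 2) := by
  have i1 := (integrable_kernel_fst hh hδ hu).const_mul t
  have i2 := (integrable_kernel_snd hh hδ hv).const_mul t⁻¹
  refine (norm_integral_le_of_norm_le ((i1.add i2).const_mul (A / 2))
    (.of_forall fun p => norm_pairForm_integrand_le hA ht δ p)).trans (le_of_eq ?_)
  rw [integral_const_mul]
  erw [integral_add i1 i2]
  rw [integral_const_mul, integral_const_mul, integral_kernel_fst hh hδ hu,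
    integral_kernel_snd hh hδ hv]
  ring

lemma star_pairForm (δ : ℝ) (u v a h : R3 → ℂ) :
    star (pairForm δ u v a h) =
      pairForm δ v u (fun x => star (a x)) (fun y => star (h (-y))) := by
  unfold pairForm
  rw [← integral_swap]
  simp only [RCLike.star_def]
  rw [← integral_conj]
  congr 1
  ext p
  simp only [Prod.fst_swap, Prod.snd_swap, map_mul, ← smul_neg, neg_sub,
    Complex.conj_conj, add_comm p.2 p.1]
  ring

/-! ### The Wigner equation -/

/-- The `i`-th vector of the standard basis of `ℝ³`. -/
abbrev stdVec (i : Fin 3) : R3 := EuclideanSpace.basisFun (Fin 3) ℝ i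

lemma laplacian_eq_sum_stdVec (f : 𝓢(R3, ℂ)) : Δ f = ∑ i, ∂_{stdVec i} (∂_{stdVec i} f) :=
  SchwartzMap.laplacian_eq_sum (EuclideanSpace.basisFun (Fin 3) ℝ) f

/-- The pointwise product of two Schwartz functions. -/
def schwartzMul (f g : 𝓢(R3, ℂ)) : 𝓢(R3, ℂ) :=
  SchwartzMap.pairing (ContinuousLinearMap.mul ℂ ℂ) f g

@[simp] lemma schwartzMul_apply (f g : 𝓢(R3, ℂ)) (x : R3) : schwartzMul f g x = f x * g x := rfl

lemma lineDerivOp_schwartzMul (m : R3) (f g : 𝓢(R3, ℂ)) :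
    ∂_{m} (schwartzMul f g) = schwartzMul (∂_{m} f) g + schwartzMul f (∂_{m} g) := by
  ext x
  simp only [add_apply, schwartzMul_apply, lineDerivOp_apply_eq_fderiv]
  have : (schwartzMul f g : R3 → ℂ) = fun x => f x * g x := rfl
  rw [this, fderiv_fun_mul f.differentiableAt g.differentiableAt]
  simp
  ring

lemma laplacian_schwartzMul (f g : 𝓢(R3, ℂ)) (x : R3) :
    Δ (schwartzMul f g) x =
      Δ f x * g x + 2 * ∑ i, ∂_{stdVec i} f x * ∂_{stdVec i} g x + f x * Δ g x := by
  simp only [laplacian_eq_sum_stdVec, lineDerivOp_schwartzMul, lineDerivOp_add,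
    sum_apply, add_apply, schwartzMul_apply, Finset.sum_add_distrib,
    Finset.sum_mul, Finset.mul_sum]
  rw [← Finset.sum_add_distrib, ← Finset.sum_add_distrib, ← Finset.sum_add_distrib,
    ← Finset.sum_add_distrib, ← Finset.sum_add_distrib]
  exact Finset.sum_congr rfl fun i _ => by ring

/-- The Schwartz function `p ↦ f (r • (p - w))`. -/
def affineComp {r : ℝ} (hr : r ≠ 0) (w : R3) (f : 𝓢(R3, ℂ)) : 𝓢(R3, ℂ) :=
  SchwartzMap.compSubConstCLM ℂ w (SchwartzMap.compCLMOfContinuousLinearEquiv ℂ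
    (ContinuousLinearEquiv.smulLeft (Units.mk0 r hr)) f)

@[simp] lemma affineComp_apply {r : ℝ} (hr : r ≠ 0) (w : R3) (f : 𝓢(R3, ℂ)) (x : R3) :
    affineComp hr w f x = f (r • (x - w)) := rfl

lemma lineDerivOp_affineComp {r : ℝ} (hr : r ≠ 0) (w m : R3) (f : 𝓢(R3, ℂ)) :
    ∂_{m} (affineComp hr w f) = r • affineComp hr w (∂_{m} f) := by
  ext x
  have h1 : HasFDerivAt (fun p : R3 => r • (p - w)) (r • ContinuousLinearMap.id ℝ R3) x :=
    ((hasFDerivAt_id x).sub_const w).const_smul r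
  have h2 := (f.hasFDerivAt (r • (x - w))).comp x h1
  simp only [lineDerivOp_apply_eq_fderiv, smul_apply, affineComp_apply]
  have : (affineComp hr w f : R3 → ℂ) = f ∘ fun p => r • (p - w) := rfl
  rw [this, h2.fderiv]
  simp

lemma laplacian_affineComp {r : ℝ} (hr : r ≠ 0) (w : R3) (f : 𝓢(R3, ℂ)) :
    Δ (affineComp hr w f) = r ^ 2 • affineComp hr w (Δ f) := by
  ext x
  simp only [laplacian_eq_sum_stdVec, lineDerivOp_affineComp, lineDerivOp_smul,
    smul_apply, affineComp_apply, sum_apply, Finset.smul_sum, smul_smul, sq]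

lemma integrable_pairForm_schwartz (a h : 𝓢(R3, ℂ)) {u v : R3 → ℂ} {δ : ℝ} (hδ : 0 < δ)
    (hu : MemLp u 2 volume) (hv : MemLp v 2 volume) :
    Integrable (fun p : R3 × R3 =>
      h (δ⁻¹ • (p.1 - p.2)) * a ((2 : ℝ)⁻¹ • (p.1 + p.2)) * (u p.1 * star (v p.2))) := by
  obtain ⟨A, -, hA⟩ := a.decay 0 0
  exact integrable_pairForm h.integrable h.continuous a.continuous
    (fun x => by simpa using hA x) hδ hu hv

/-- The Wigner equation of a solution. It is the weak equation tested against
`p ↦ h ((p - z) / δ) a ((p + z) / 2)`, which is compactly supported since `a` is. -/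
lemma wigner_equation {c ε δ : ℝ} (hδ : 0 < δ) {f u v : R3 → ℂ}
    (hu : IsHelmholtzSolution c ε f u) (hf : MemLp f 2 volume) (hv : MemLp v 2 volume)
    (a h : 𝓢(R3, ℂ)) (ha : HasCompactSupport a) :
    ((((ε ^ 2)⁻¹ : ℝ) : ℂ) - Complex.I * ((c / ε : ℝ) : ℂ)) * pairForm δ u v a h
      + ((δ⁻¹ ^ 2 : ℝ) : ℂ) * pairForm δ u v a (Δ h : 𝓢(R3, ℂ))
      + ((δ⁻¹ : ℝ) : ℂ) * ∑ i, pairForm δ u v (∂_{stdVec i} a : 𝓢(R3, ℂ)) (∂_{stdVec i} h : 𝓢(R3, ℂ))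
      + 1 / 4 * pairForm δ u v (Δ a : 𝓢(R3, ℂ)) h = pairForm δ f v a h := by
  have hδ' : δ⁻¹ ≠ 0 := inv_ne_zero hδ.ne'
  have h2 : (2 : ℝ)⁻¹ ≠ 0 := by norm_num
  -- the test function for a frozen second variable `z`
  set φ : R3 → 𝓢(R3, ℂ) := fun z =>
    schwartzMul (affineComp hδ' z h) (affineComp h2 (-z) a) with hφ
  have hφ_apply (p z : R3) : φ z p = h (δ⁻¹ • (p - z)) * a ((2 : ℝ)⁻¹ • (p + z)) := by
    simp [hφ]
  have hΔφ (p z : R3) : Laplacian.laplacian (φ z : R3 → ℂ) p =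
      ((δ⁻¹ ^ 2 : ℝ) : ℂ) * (Δ h (δ⁻¹ • (p - z)) * a ((2 : ℝ)⁻¹ • (p + z)))
      + ((δ⁻¹ : ℝ) : ℂ) * ∑ i, ∂_{stdVec i} h (δ⁻¹ • (p - z)) *
          ∂_{stdVec i} a ((2 : ℝ)⁻¹ • (p + z))
      + 1 / 4 * (h (δ⁻¹ • (p - z)) * Δ a ((2 : ℝ)⁻¹ • (p + z))) := by
    rw [← SchwartzMap.laplacian_apply, hφ, laplacian_schwartzMul, laplacian_affineComp,
      laplacian_affineComp]
    simp only [lineDerivOp_affineComp, smul_apply, affineComp_apply, Complex.real_smul,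
      sub_neg_eq_add, Finset.mul_sum]
    congr 1
    · congr 1
      · ring
      · refine Finset.sum_congr rfl fun i _ => ?_
        push_cast
        ring
    · push_cast
      ring
  have key (z : R3) := hu.2 (φ z) ((φ z).smooth ⊤) (by
      have : HasCompactSupport (affineComp h2 (-z) a) :=
        ha.comp_homeomorph ((Homeomorph.subRight (-z)).trans
          (Homeomorph.smulOfNeZero (2 : ℝ)⁻¹ h2))
      exact this.mul_left)
  have hI (a h : 𝓢(R3, ℂ)) := integrable_pairForm_schwartz a h hδ hu.1 hv
  have hIf := integrable_pairForm_schwartz a h hδ hf hv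
  have hIsum : Integrable (fun p : R3 × R3 => ∑ i,
      ∂_{stdVec i} h (δ⁻¹ • (p.1 - p.2)) * ∂_{stdVec i} a ((2 : ℝ)⁻¹ • (p.1 + p.2)) *
        (u p.1 * star (v p.2))) :=
    integrable_finsetSum _ fun i _ => hI _ _
  have i1 := (hI a h).const_mul ((((ε ^ 2)⁻¹ : ℝ) : ℂ) - Complex.I * ((c / ε : ℝ) : ℂ))
  have i2 := (hI a (Δ h)).const_mul ((δ⁻¹ ^ 2 : ℝ) : ℂ)
  have i3 := hIsum.const_mul ((δ⁻¹ : ℝ) : ℂ)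
  have i4 := (hI (Δ a) h).const_mul (1 / 4)
  unfold pairForm
  rw [← integral_finsetSum _ fun i _ => hI _ _, ← integral_const_mul, ← integral_const_mul,
    ← integral_const_mul, ← integral_const_mul, ← integral_add i1 i2,
    ← integral_add (i1.fun_add i2) i3, ← integral_add ((i1.fun_add i2).fun_add i3) i4]
  rw [Measure.volume_eq_prod] at i1 i2 i3 i4 hIf ⊢
  rw [integral_prod_symm _ (((i1.fun_add i2).fun_add i3).fun_add i4), integral_prod_symm _ hIf]
  refine integral_congr_ae (.of_forall fun z => ?_)
  have hz := congrArg (· * star (v z)) (key z)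
  simp only [← integral_mul_const] at hz
  calc _ = _ := integral_congr_ae (.of_forall fun p => ?_)
    _ = _ := hz
    _ = _ := integral_congr_ae (.of_forall fun p => ?_)
  · simp only [hΔφ, hφ_apply, ← Finset.sum_mul]
    ring
  · simp only [hφ_apply]
    ring

/-! ### The energy estimate -/

lemma star_lineDerivOp {f : 𝓢(R3, ℂ)} (hf : ∀ x, star (f x) = f x) (m x : R3) :
    star (∂_{m} f x) = ∂_{m} f x := by
  have h1 : HasFDerivAt (fun y => (f y).im) (Complex.imCLM.comp (fderiv ℝ f x)) x :=
    Complex.imCLM.hasFDerivAt.comp x (f.hasFDerivAt x)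
  have h2 : (fun y => (f y).im) = fun _ => (0 : ℝ) := by
    ext y
    exact Complex.conj_eq_iff_im.1 (hf y)
  rw [h2] at h1
  have h3 := congrArg (fun L => L m) (h1.unique (hasFDerivAt_const (0 : ℝ) x))
  exact Complex.conj_eq_iff_im.2 (by simpa [lineDerivOp_apply_eq_fderiv] using h3)

lemma star_laplacian {f : 𝓢(R3, ℂ)} (hf : ∀ x, star (f x) = f x) (x : R3) :
    star (Δ f x) = Δ f x := by
  simp only [laplacian_eq_sum_stdVec, sum_apply, star_sum]
  exact Finset.sum_congr rfl fun i _ => star_lineDerivOp (star_lineDerivOp hf _) _ _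

/-- Obtained from the scaling rule for `r = -1`. -/
lemma laplacian_neg_of_even {f : 𝓢(R3, ℂ)} (hf : ∀ x, f (-x) = f x) (x : R3) :
    Δ f (-x) = Δ f x := by
  have h1 : (-1 : ℝ) ≠ 0 := by norm_num
  have h2 : affineComp h1 0 f = f := by
    ext y
    simpa using hf y
  have h3 := congrArg (fun g : 𝓢(R3, ℂ) => g x) (laplacian_affineComp h1 0 f)
  rw [h2] at h3
  simpa using h3.symm

/-- For a real multiplier and a real even kernel, the form is Hermitian. -/
lemma im_pairForm_self_eq_zero {δ : ℝ} {u a h : R3 → ℂ} (ha : ∀ x, star (a x) = a x)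
    (hh : ∀ y, star (h y) = h y) (hh' : ∀ y, h (-y) = h y) : (pairForm δ u u a h).im = 0 := by
  apply Complex.conj_eq_iff_im.1
  have := star_pairForm δ u u a h
  simp only [ha, hh, hh'] at this
  exact this

/-- The imaginary part of the Wigner equation with `v = u`: the absorption term controls
`J(u, u)` up to the transport term, in which `a` is differentiated. -/
lemma absorption_le {c ε : ℝ} {f u : R3 → ℂ} (hu : IsHelmholtzSolution c ε f u)
    (hf : MemLp f 2 volume) {a h : 𝓢(R3, ℂ)} (ha : HasCompactSupport a)
    (ha_real : ∀ x, star (a x) = a x) (hh_real : ∀ y, star (h y) = h y)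
    (hh_even : ∀ y, h (-y) = h y) :
    c / ε * (pairForm 1 u u a h).re ≤
      ∑ i, ‖pairForm 1 u u (∂_{stdVec i} a : 𝓢(R3, ℂ)) (∂_{stdVec i} h : 𝓢(R3, ℂ))‖
        + ‖pairForm 1 f u a h‖ := by
  have h0 := congrArg Complex.im (wigner_equation one_pos hu hf hu.1 a h ha)
  have h1 := im_pairForm_self_eq_zero (δ := 1) (u := u) ha_real hh_real hh_even
  have h2 := im_pairForm_self_eq_zero (δ := 1) (u := u) ha_real (star_laplacian hh_real)
    (laplacian_neg_of_even hh_even)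
  have h3 := im_pairForm_self_eq_zero (δ := 1) (u := u) (star_laplacian ha_real) hh_real hh_even
  have h4 : (1 / 4 * pairForm 1 u u (Δ a : 𝓢(R3, ℂ)) h).im = 0 := by
    have : (1 / 4 : ℂ) = ((1 / 4 : ℝ) : ℂ) := by norm_num
    rw [this, Complex.im_ofReal_mul, h3, mul_zero]
  rw [Complex.add_im, Complex.add_im, Complex.add_im, h4, Complex.im_ofReal_mul, h2,
    Complex.mul_im, h1] at h0
  simp only [inv_one, Complex.ofReal_one, one_mul, mul_zero, add_zero, zero_add, Complex.sub_im,
    Complex.mul_im, Complex.ofReal_im, Complex.I_re, Complex.I_im, Complex.ofReal_re,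
    zero_sub] at h0
  have h5 := (Complex.abs_im_le_norm (∑ i, pairForm 1 u u (∂_{stdVec i} a : 𝓢(R3, ℂ))
    (∂_{stdVec i} h : 𝓢(R3, ℂ)))).trans (norm_sum_le _ _)
  have h6 := Complex.abs_im_le_norm (pairForm 1 f u a h)
  have h7 := le_abs_self (∑ i, pairForm 1 u u (∂_{stdVec i} a : 𝓢(R3, ℂ))
    (∂_{stdVec i} h : 𝓢(R3, ℂ))).im
  have h8 := neg_abs_le (pairForm 1 f u a h).im
  linarith

/-- A smooth real function on `ℝ³` with compact support, as a complex Schwartz function. -/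
def ofRealSchwartz (χ : R3 → ℝ) (h1 : HasCompactSupport χ) (h2 : ContDiff ℝ ∞ χ) : 𝓢(R3, ℂ) :=
  HasCompactSupport.toSchwartzMap (f := fun x => (χ x : ℂ)) (h1.comp_left Complex.ofReal_zero)
    (Complex.ofRealCLM.contDiff.comp h2)

@[simp] lemma ofRealSchwartz_apply (χ : R3 → ℝ) (h1 : HasCompactSupport χ)
    (h2 : ContDiff ℝ ∞ χ) (x : R3) : ofRealSchwartz χ h1 h2 x = (χ x : ℂ) := rfl

lemma tsupport_ofRealSchwartz_subset (χ : R3 → ℝ) (h1 : HasCompactSupport χ)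
    (h2 : ContDiff ℝ ∞ χ) : tsupport (ofRealSchwartz χ h1 h2) ⊆ tsupport χ := by
  refine closure_mono fun x hx h0 => hx ?_
  rw [ofRealSchwartz_apply, h0, Complex.ofReal_zero]

lemma hasCompactSupport_ofRealSchwartz (χ : R3 → ℝ) (h1 : HasCompactSupport χ)
    (h2 : ContDiff ℝ ∞ χ) : HasCompactSupport (ofRealSchwartz χ h1 h2) :=
  h1.of_isClosed_subset (isClosed_tsupport _) (tsupport_ofRealSchwartz_subset χ h1 h2)

/-- Exhausting `ℝ³` by cutoffs removes the transport term. -/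
lemma absorption_le_of_even {c ε : ℝ} {f u : R3 → ℂ}
    (hu : IsHelmholtzSolution c ε f u) (hf : MemLp f 2 volume) {h : 𝓢(R3, ℂ)}
    (hh_real : ∀ y, star (h y) = h y) (hh_even : ∀ y, h (-y) = h y) {t : ℝ} (ht : 0 < t) :
    c / ε * (pairForm 1 u u 1 h).re ≤
      1 / 2 * (∫ y, ‖h y‖) * (t * (∫ x, ‖f x‖ ^ 2) + t⁻¹ * ∫ x, ‖u x‖ ^ 2) := by
  let b : ContDiffBump (0 : R3) := ⟨1, 2, one_pos, one_lt_two⟩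
  let χ : 𝓢(R3, ℂ) := ofRealSchwartz b b.hasCompactSupport b.contDiff
  have hr (n : ℕ) : ((n + 1 : ℝ)⁻¹) ≠ 0 := by positivity
  let a (n : ℕ) : 𝓢(R3, ℂ) := affineComp (hr n) 0 χ
  have ha_real (n : ℕ) (x : R3) : star (a n x) = a n x := by simp [a, χ]
  have ha_le (n : ℕ) (x : R3) : ‖a n x‖ ≤ 1 := by
    simp [a, χ, abs_of_nonneg b.nonneg, b.le_one]
  have ha_supp (n : ℕ) : HasCompactSupport (a n) :=
    (hasCompactSupport_ofRealSchwartz _ b.hasCompactSupport b.contDiff).comp_homeomorph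
      ((Homeomorph.subRight 0).trans (Homeomorph.smulOfNeZero _ (hr n)))
  have hlim1 : Tendsto (fun n => pairForm 1 u u (a n) h) atTop (𝓝 (pairForm 1 u u 1 h)) := by
    have hdom := integrable_pairForm h.integrable h.continuous (continuous_const (y := (1 : ℂ)))
      (A := 1) (fun _ => by simp) one_pos hu.1 hu.1
    refine tendsto_integral_of_dominated_convergence _
      (fun n => (integrable_pairForm_schwartz (a n) h one_pos hu.1 hu.1).1) hdom.norm
      (fun n => .of_forall fun p => ?_) (.of_forall fun p => ?_)
    · simp only [norm_mul, mul_one]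
      gcongr
      exact mul_le_of_le_one_right (norm_nonneg _) (ha_le n _)
    · refine Tendsto.mul_const _ (Tendsto.const_mul _ ?_)
      have hs : Tendsto (fun n : ℕ => ((n + 1 : ℝ)⁻¹) • ((2 : ℝ)⁻¹ • (p.1 + p.2) - 0)) atTop
          (𝓝 ((0 : ℝ) • ((2 : ℝ)⁻¹ • (p.1 + p.2) - 0))) := by
        refine Tendsto.smul_const ?_ _
        simpa using tendsto_one_div_add_atTop_nhds_zero_nat (𝕜 := ℝ)
      have := (χ.continuous.tendsto _).comp hs
      have h1 : χ ((0 : ℝ) • ((2 : ℝ)⁻¹ • (p.1 + p.2) - 0)) = 1 := by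
        simp only [zero_smul, χ, ofRealSchwartz_apply]
        rw [b.one_of_mem_closedBall (by simp [b])]
        simp
      rw [h1] at this
      exact this
  have hlim2 (i : Fin 3) : Tendsto (fun n =>
      ‖pairForm 1 u u (∂_{stdVec i} (a n) : 𝓢(R3, ℂ)) (∂_{stdVec i} h : 𝓢(R3, ℂ))‖) atTop
      (𝓝 0) := by
    obtain ⟨A, -, hA⟩ := (∂_{stdVec i} χ : 𝓢(R3, ℂ)).decay 0 0
    have hA' (n : ℕ) (x : R3) : ‖(∂_{stdVec i} (a n) : 𝓢(R3, ℂ)) x‖ ≤ (n + 1 : ℝ)⁻¹ * A := by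
      simp only [a, lineDerivOp_affineComp, smul_apply, affineComp_apply, norm_smul]
      rw [Real.norm_of_nonneg (by positivity)]
      gcongr
      simpa using hA _
    refine squeeze_zero (fun _ => norm_nonneg _) (fun n => norm_pairForm_le
      (SchwartzMap.integrable _) (hA' n) one_pos hu.1 hu.1 one_pos) ?_
    have h0 : Tendsto (fun n : ℕ => (n + 1 : ℝ)⁻¹) atTop (𝓝 0) := by
      simpa using tendsto_one_div_add_atTop_nhds_zero_nat (𝕜 := ℝ)
    have := (((h0.mul_const A).div_const 2).mul_const
      ((1 : ℝ) ^ 3 * ∫ y, ‖(∂_{stdVec i} h : 𝓢(R3, ℂ)) y‖)).mul_const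
      ((1 : ℝ) * (∫ x, ‖u x‖ ^ 2) + (1 : ℝ)⁻¹ * ∫ x, ‖u x‖ ^ 2)
    simpa using this
  have hlim3 := (((Complex.continuous_re.tendsto _).comp hlim1).const_mul (c / ε))
  have hlim4 := (tendsto_finsetSum Finset.univ fun i _ => hlim2 i).add_const
    (1 / 2 * (∫ y, ‖h y‖) * (t * (∫ x, ‖f x‖ ^ 2) + t⁻¹ * ∫ x, ‖u x‖ ^ 2))
  rw [Finset.sum_const_zero, zero_add] at hlim4
  refine le_of_tendsto_of_tendsto' hlim3 hlim4 fun n => ?_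
  refine (absorption_le hu hf (ha_supp n) (ha_real n) hh_real hh_even).trans ?_
  gcongr
  simpa using norm_pairForm_le (h.integrable) (ha_le n) one_pos hf hu.1 ht

/-- The autocorrelation of an `L²` function is continuous, by continuity of translations. -/
lemma continuous_autocorrelation {u : R3 → ℂ} (hu : MemLp u 2 volume) :
    Continuous fun y : R3 => ∫ z, u (z + y) * star (u z) := by
  have hmp (y : R3) : MeasurePreserving (fun z : R3 => z + y) volume volume :=
    measurePreserving_add_right volume y
  let g : C(R3, C(R3, R3)) :=
    ContinuousMap.curry ⟨fun p : R3 × R3 => p.2 + p.1, by fun_prop⟩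
  have hc : Continuous fun y : R3 => Lp.compMeasurePreserving (g y) (hmp y) (hu.toLp u) :=
    Continuous.compMeasurePreservingLp (f := fun _ : R3 => hu.toLp u) continuous_const
      g.continuous hmp (by simp)
  have hc2 := (continuous_const (y := hu.toLp u)).inner (𝕜 := ℂ) hc
  refine hc2.congr fun y => ?_
  rw [L2.inner_def]
  refine integral_congr_ae ?_
  have h1 := Lp.coeFn_compMeasurePreserving (hu.toLp u) (hmp y)
  have h2 := (hmp y).quasiMeasurePreserving.ae_eq_comp hu.coeFn_toLp
  filter_upwards [h1, h2, hu.coeFn_toLp] with z hz1 hz2 hz3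
  have : (Lp.compMeasurePreserving (g y) (hmp y) (hu.toLp u)) z = u (z + y) :=
    hz1.trans hz2
  rw [this, hz3]
  simp [RCLike.inner_apply]

/-- Without the cutoff, the form averages the autocorrelation of `u` against the kernel. -/
lemma pairForm_one_eq_integral {u : R3 → ℂ} (hu : MemLp u 2 volume) {h : R3 → ℂ}
    (hh : Integrable h) (hhc : Continuous h) :
    pairForm 1 u u 1 h = ∫ y, h y * ∫ z, u (z + y) * star (u z) := by
  have hI := integrable_pairForm hh hhc (continuous_const (y := (1 : ℂ)))
      (A := 1) (fun _ => by simp) one_pos hu hu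
  have hmp : MeasurePreserving (fun p : R3 × R3 => (p.1, p.1 + p.2)) (volume.prod volume)
      (volume.prod volume) := measurePreserving_prod_add volume volume
  have hI2 : Integrable (fun p : R3 × R3 => h p.2 * (u (p.1 + p.2) * star (u p.1)))
      (volume.prod volume) := by
    refine (hmp.integrable_comp_of_integrable hI.swap).congr (.of_forall fun p => ?_)
    simp
  unfold pairForm
  rw [Measure.volume_eq_prod] at hI ⊢
  simp only [Pi.one_apply]
  rw [integral_prod_symm _ hI]
  calc _ = ∫ z, ∫ y, h y * (u (z + y) * star (u z)) := by
        refine integral_congr_ae (.of_forall fun z => ?_)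
        simp only
        rw [← integral_add_left_eq_self _ z]
        simp
    _ = ∫ y, ∫ z, h y * (u (z + y) * star (u z)) := integral_integral_swap hI2
    _ = _ := by simp_rw [integral_const_mul]

/-- The energy estimate: the absorption `c / ε` controls the `L²` norm of the solution. -/
lemma energy_estimate {c ε : ℝ} (hc : 0 < c) (hε : 0 < ε) {f u : R3 → ℂ}
    (hu : IsHelmholtzSolution c ε f u) (hf : MemLp f 2 volume) :
    ∫ x, ‖u x‖ ^ 2 ≤ (ε / c) ^ 2 * ∫ x, ‖f x‖ ^ 2 := by
  let φ (n : ℕ) : ContDiffBump (0 : R3) :=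
    ⟨(n + 1 : ℝ)⁻¹ / 2, (n + 1 : ℝ)⁻¹, by positivity, half_lt_self (by positivity)⟩
  let h (n : ℕ) : 𝓢(R3, ℂ) := ofRealSchwartz ((φ n).normed volume)
    (φ n).hasCompactSupport_normed (φ n).contDiff_normed
  have hnorm (n : ℕ) : ∫ y, ‖h n y‖ = 1 := by
    simp only [h, ofRealSchwartz_apply, Complex.norm_real,
      Real.norm_of_nonneg ((φ n).nonneg_normed _)]
    exact (φ n).integral_normed
  have hlim : Tendsto (fun n => (pairForm 1 u u 1 (h n)).re) atTop (𝓝 (∫ x, ‖u x‖ ^ 2)) := by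
    have hc : Continuous fun w : R3 => ∫ z, u (z + -w) * star (u z) :=
      (continuous_autocorrelation hu.1).comp continuous_neg
    have h1 := ContDiffBump.convolution_tendsto_right_of_continuous (φ := φ) (μ := volume)
      (l := atTop) (by simpa [φ] using tendsto_one_div_add_atTop_nhds_zero_nat (𝕜 := ℝ)) hc 0
    have h2 := (Complex.continuous_re.tendsto _).comp h1
    have h3 : (∫ z, u (z + -0) * star (u z)).re = ∫ x, ‖u x‖ ^ 2 := by
      have : ∀ z, u (z + -0) * star (u z) = ((‖u z‖ ^ 2 : ℝ) : ℂ) := fun z => by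
        simpa using Complex.mul_conj' (u z)
      simp_rw [this, integral_complex_ofReal, Complex.ofReal_re]
    rw [h3] at h2
    refine h2.congr fun n => ?_
    rw [pairForm_one_eq_integral hu.1 (h n).integrable (h n).continuous]
    simp [convolution_def, h]
  -- the weight `t = ε / c` lets half of the left-hand side absorb the term in `u`
  have h1 (n : ℕ) := absorption_le_of_even hu hf (h := h n) (fun y => by simp [h])
    (fun y => by simp [h, (φ n).normed_neg]) (t := ε / c) (by positivity)
  simp only [hnorm] at h1
  have h2 := le_of_tendsto' (hlim.const_mul (c / ε)) h1
  have h3 : (ε / c)⁻¹ = c / ε := inv_div _ _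
  rw [h3] at h2
  have h4 : c / ε * ∫ x, ‖u x‖ ^ 2 ≤ ε / c * ∫ x, ‖f x‖ ^ 2 := by linarith
  calc ∫ x, ‖u x‖ ^ 2 = ε / c * (c / ε * ∫ x, ‖u x‖ ^ 2) := by field_simp
    _ ≤ ε / c * (ε / c * ∫ x, ‖f x‖ ^ 2) := by gcongr
    _ = _ := by ring

/-! ### The Wigner transform of tensor products -/

lemma measurePreserving_smul_snd {r : ℝ} (hr : r ≠ 0) :
    MeasurePreserving (fun p : R3 × R3 => (p.1, r • p.2)) volume
      (ENNReal.ofReal |(r ^ 3)⁻¹| • volume) := by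
  have h1 : MeasurePreserving (fun y : R3 => r • y) volume
      (ENNReal.ofReal |(r ^ 3)⁻¹| • volume) :=
    ⟨measurable_const_smul r, by simpa using Measure.map_addHaar_smul (volume : Measure R3) hr⟩
  have h2 := (MeasurePreserving.id (volume : Measure R3)).prod h1
  rw [Measure.prod_smul_right] at h2
  exact h2

/-- The change of variables `(x, y) ↦ (x + ε y / 2, x - ε y / 2)` has Jacobian `ε ^ 3`. -/
lemma measurePreserving_wigner {ε : ℝ} (hε : 0 < ε) :
    MeasurePreserving (fun p : R3 × R3 => (p.1 + (ε / 2) • p.2, p.1 - (ε / 2) • p.2)) volume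
      (ENNReal.ofReal (ε ^ 3)⁻¹ • volume) := by
  have h1 := measurePreserving_smul_snd (half_pos hε).ne'
  have h2 : MeasurePreserving (fun p : R3 × R3 => (p.1 + p.2, p.1)) volume volume :=
    Measure.measurePreserving_swap.comp (measurePreserving_prod_add volume volume)
  have h3 := measurePreserving_smul_snd (two_ne_zero (α := ℝ))
  have h4 : MeasurePreserving (fun p : R3 × R3 => (p.1, -p.1 + p.2)) volume volume :=
    measurePreserving_prod_neg_add volume volume
  have h5 := (((h4.smul_measure _).comp h3).comp h2).smul_measure
    (ENNReal.ofReal |((ε / 2) ^ 3)⁻¹|) |>.comp h1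
  convert h5 using 1
  · ext1 p
    simp [two_smul]
    module
  · rw [smul_smul, ← ENNReal.ofReal_mul (abs_nonneg _), ← abs_mul, abs_of_pos (by positivity)]
    congr 2
    field_simp

lemma integrable_comp_wigner {ε : ℝ} (hε : 0 < ε) {g : R3 × R3 → ℂ} (hg : Integrable g) :
    Integrable fun p : R3 × R3 => g (p.1 + (ε / 2) • p.2, p.1 - (ε / 2) • p.2) :=
  (measurePreserving_wigner hε).integrable_comp_of_integrable
    (hg.smul_measure ENNReal.ofReal_ne_top)

lemma integral_comp_wigner {ε : ℝ} (hε : 0 < ε) {g : R3 × R3 → ℂ} (hg : Integrable g) :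
    ∫ p : R3 × R3, g (p.1 + (ε / 2) • p.2, p.1 - (ε / 2) • p.2) = (ε ^ 3)⁻¹ • ∫ p, g p := by
  have h := measurePreserving_wigner hε
  have h1 := hg.smul_measure (c := ENNReal.ofReal (ε ^ 3)⁻¹) ENNReal.ofReal_ne_top
  rw [← h.map_eq] at h1
  have h2 := integral_map h.aemeasurable h1.1
  rw [h.map_eq, integral_smul_measure, ENNReal.toReal_ofReal (by positivity)] at h2
  exact h2.symm

lemma measurePreserving_rearrange :
    MeasurePreserving (fun q : (R3 × R3) × R3 => ((q.1.1, q.2), q.1.2)) volume volume := by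
  have h1 : MeasurePreserving (MeasurableEquiv.prodAssoc : (R3 × R3) × R3 ≃ᵐ R3 × R3 × R3)
      volume volume := measurePreserving_prodAssoc volume volume volume
  have h2 : MeasurePreserving (Prod.swap : R3 × R3 → R3 × R3) volume volume :=
    Measure.measurePreserving_swap
  have h3 := (MeasurePreserving.id (volume : Measure R3)).prod h2
  exact (h1.symm _).comp (h3.comp h1)

/-- Tested against a tensor product `a ⊗ b`, the Wigner transform is a form `pairForm` with kernel
`𝓕 b`; the scale `2 π ε` accounts for the normalization of `𝓕`. -/
lemma integral_wigner_mul {ε : ℝ} (hε : 0 < ε) {u : R3 → ℂ} (hu : MemLp u 2 volume)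
    (a b : 𝓢(R3, ℂ)) :
    ∫ p, wigner ε u p * (a p.1 * b p.2) =
      (((2 * Real.pi) ^ 3)⁻¹ * (ε ^ 3)⁻¹ : ℝ) •
        pairForm (2 * Real.pi * ε) u u a (𝓕 b : 𝓢(R3, ℂ)) := by
  set V : R3 × R3 → ℂ := fun p =>
    a p.1 * (u (p.1 + (ε / 2) • p.2) * star (u (p.1 - (ε / 2) • p.2))) with hV
  have hVint : Integrable V := by
    -- the reflection `z ↦ -z` turns `a ((p + z) / 2)` into a convolution kernel
    have hun : MemLp (fun z => u (-z)) 2 volume :=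
      hu.comp_measurePreserving (Measure.measurePreserving_neg volume)
    have h1 := integrable_pairForm a.integrable a.continuous (continuous_const (y := (1 : ℂ)))
      (A := 1) (fun _ => by simp) two_pos hu hun
    have h2 : MeasurePreserving (fun p : R3 × R3 => (p.1, -p.2)) volume volume :=
      (MeasurePreserving.id (volume : Measure R3)).prod (Measure.measurePreserving_neg volume)
    refine (integrable_comp_wigner hε (h2.integrable_comp_of_integrable h1)).congr
      (.of_forall fun p => ?_)
    have h3 : (2 : ℝ)⁻¹ • (p.1 + (ε / 2) • p.2 + (p.1 - (ε / 2) • p.2)) = p.1 := by module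
    simp only [Function.comp_apply, sub_neg_eq_add, neg_neg, mul_one, hV, h3]
  have hphase : Continuous fun q : (R3 × R3) × R3 =>
      Complex.exp (-Complex.I * ((inner ℝ q.1.2 q.2 : ℝ) : ℂ)) := by fun_prop
  set F : (R3 × R3) × R3 → ℂ := fun q =>
    Complex.exp (-Complex.I * ((inner ℝ q.1.2 q.2 : ℝ) : ℂ)) * (V q.1 * b q.2) with hFdef
  have hF : Integrable F := by
    have h1 : Integrable (fun q : (R3 × R3) × R3 => V q.1 * b q.2) := hVint.mul_prod b.integrable
    refine h1.bdd_mul (c := 1) hphase.aestronglyMeasurable (.of_forall fun q => ?_)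
    rw [Complex.norm_exp]
    simp
  have hmp := measurePreserving_rearrange
  have hF' := hmp.integrable_comp_of_integrable hF
  have hswap : ∫ q : (R3 × R3) × R3, F ((q.1.1, q.2), q.1.2) = ∫ q, F q := by
    have := integral_map hmp.aemeasurable (hmp.map_eq.symm ▸ hF.1)
    rw [hmp.map_eq] at this
    exact this.symm
  have hinner (p : R3 × R3) : ∫ ξ, F (p, ξ) =
      V p * (𝓕 b : 𝓢(R3, ℂ)) ((2 * Real.pi)⁻¹ • p.2) := by
    rw [SchwartzMap.fourier_coe, Real.fourier_eq', ← integral_const_mul]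
    refine integral_congr_ae (.of_forall fun ξ => ?_)
    have h1 : -2 * Real.pi * inner ℝ ξ ((2 * Real.pi)⁻¹ • p.2) = -inner ℝ p.2 ξ := by
      rw [real_inner_smul_right, real_inner_comm]
      field_simp
    simp only [hFdef, h1, smul_eq_mul, Complex.ofReal_neg]
    rw [show -Complex.I * ((inner ℝ p.2 ξ : ℝ) : ℂ) = -((inner ℝ p.2 ξ : ℝ) : ℂ) * Complex.I by
      ring]
    ring
  have hpair := integrable_pairForm_schwartz a (𝓕 b : 𝓢(R3, ℂ)) (δ := 2 * Real.pi * ε)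
    (by positivity) hu hu
  calc ∫ p, wigner ε u p * (a p.1 * b p.2)
      = ∫ p : R3 × R3, (((2 * Real.pi) ^ 3)⁻¹ : ℝ) • ∫ y, F ((p.1, y), p.2) := by
        refine integral_congr_ae (.of_forall fun p => ?_)
        simp only [wigner, smul_mul_assoc, ← integral_mul_const]
        congr 2
        ext y
        simp only [hFdef, hV]
        ring
    _ = (((2 * Real.pi) ^ 3)⁻¹ : ℝ) • ∫ q : (R3 × R3) × R3, F ((q.1.1, q.2), q.1.2) := by
        rw [integral_smul]
        congr 1
        exact (integral_prod _ hF').symm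
    _ = (((2 * Real.pi) ^ 3)⁻¹ : ℝ) • ∫ p, ∫ ξ, F (p, ξ) := by
        rw [hswap]
        congr 1
        exact integral_prod _ hF
    _ = (((2 * Real.pi) ^ 3)⁻¹ : ℝ) • ((ε ^ 3)⁻¹ : ℝ) •
          pairForm (2 * Real.pi * ε) u u a (𝓕 b : 𝓢(R3, ℂ)) := by
        rw [pairForm, ← integral_comp_wigner hε hpair]
        congr 1
        refine integral_congr_ae (.of_forall fun p => ?_)
        have h1 : (2 : ℝ)⁻¹ • (p.1 + (ε / 2) • p.2 + (p.1 - (ε / 2) • p.2)) = p.1 := by module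
        have h2 : (2 * Real.pi * ε)⁻¹ • (p.1 + (ε / 2) • p.2 - (p.1 - (ε / 2) • p.2)) =
            (2 * Real.pi)⁻¹ • p.2 := by
          rw [show p.1 + (ε / 2) • p.2 - (p.1 - (ε / 2) • p.2) = ε • p.2 by module, smul_smul]
          congr 1
          field_simp
        simp only [hinner, h1, h2, hV]
        ring
    _ = _ := by rw [smul_smul]

/-! ### Elliptic regularity away from the unit sphere -/

/-- Test functions in the frequency variable: compactly supported, away from the unit sphere. -/
structure OffSphere (b : 𝓢(R3, ℂ)) : Prop where
  hasCompactSupport : HasCompactSupport b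
  tsupport_subset : tsupport b ⊆ {ξ | ‖ξ‖ ^ 2 ≠ 1}

lemma OffSphere.mono {b b' : 𝓢(R3, ℂ)} (hb : OffSphere b) (h : ∀ ξ, b ξ = 0 → b' ξ = 0) :
    OffSphere b' := by
  have hs : Function.support b' ⊆ Function.support b := fun ξ hξ h0 => hξ (h ξ h0)
  exact ⟨hb.1.mono hs, (closure_mono hs).trans hb.2⟩

/-- The multiplier `1 - |ξ|²` is invertible on the class `OffSphere`. -/
lemma OffSphere.exists_div {b : 𝓢(R3, ℂ)} (hb : OffSphere b) :
    ∃ g : 𝓢(R3, ℂ), OffSphere g ∧ ∀ ξ, b ξ = (1 - ‖ξ‖ ^ 2 : ℝ) * g ξ := by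
  have hsmooth : ContDiff ℝ ∞ fun ξ : R3 => ((1 - ‖ξ‖ ^ 2 : ℝ)⁻¹ : ℝ) • b ξ := by
    refine contDiff_iff_contDiffAt.2 fun ξ => ?_
    by_cases hξ : ξ ∈ tsupport b
    · have h1 : (1 - ‖ξ‖ ^ 2 : ℝ) ≠ 0 := fun h => hb.2 hξ (by linarith)
      have h2 : ContDiffAt ℝ ∞ (fun ξ : R3 => (1 - ‖ξ‖ ^ 2 : ℝ)) ξ :=
        (contDiff_const.sub (contDiff_norm_sq ℝ)).contDiffAt
      exact (h2.inv h1).smul (b.smooth ⊤).contDiffAt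
    · have h1 : (fun ξ : R3 => ((1 - ‖ξ‖ ^ 2 : ℝ)⁻¹ : ℝ) • b ξ) =ᶠ[𝓝 ξ] fun _ => 0 := by
        filter_upwards [notMem_tsupport_iff_eventuallyEq.1 hξ] with x hx
        simp [hx]
      exact contDiffAt_const.congr_of_eventuallyEq h1
  have hsupp : HasCompactSupport fun ξ : R3 => ((1 - ‖ξ‖ ^ 2 : ℝ)⁻¹ : ℝ) • b ξ :=
    hb.1.mono fun ξ hξ h0 => hξ (by simp [h0])
  obtain ⟨g, hg⟩ : ∃ g : 𝓢(R3, ℂ), ∀ ξ, g ξ = ((1 - ‖ξ‖ ^ 2 : ℝ)⁻¹ : ℝ) • b ξ :=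
    ⟨hsupp.toSchwartzMap hsmooth, fun _ => rfl⟩
  refine ⟨g, hb.mono fun ξ h => by simp [hg, h], fun ξ => ?_⟩
  rw [hg, Complex.real_smul]
  by_cases h : b ξ = 0
  · simp [h]
  · have h1 : (1 - ‖ξ‖ ^ 2 : ℝ) ≠ 0 := fun h' => hb.2 (subset_tsupport _ h) (by linarith)
    rw [← mul_assoc, ← Complex.ofReal_mul, mul_inv_cancel₀ h1, Complex.ofReal_one, one_mul]

lemma hasTemperateGrowth_inner_right (m : R3) :
    (fun ξ : R3 => inner ℝ ξ m).HasTemperateGrowth :=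
  ((innerSL ℝ).flip m).hasTemperateGrowth

lemma OffSphere.lineDerivOp_fourier {b : 𝓢(R3, ℂ)} (hb : OffSphere b) (m : R3) :
    ∃ g : 𝓢(R3, ℂ), OffSphere g ∧ ∂_{m} (𝓕 b) = 𝓕 g := by
  refine ⟨_, hb.mono fun ξ h => ?_, SchwartzMap.lineDerivOp_fourier_eq b m⟩
  simp [SchwartzMap.smulLeftCLM_apply_apply (hasTemperateGrowth_inner_right m), h]

/-- On the Fourier side, `1 + Δ / (4 π²)` is multiplication by `1 - |ξ|²`. -/
lemma fourier_add_laplacian {b g : 𝓢(R3, ℂ)} (h : ∀ ξ, b ξ = (1 - ‖ξ‖ ^ 2 : ℝ) * g ξ) (y : R3) :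
    (𝓕 g : 𝓢(R3, ℂ)) y + (((2 * Real.pi)⁻¹ ^ 2 : ℝ) : ℂ) * (Δ (𝓕 g) : 𝓢(R3, ℂ)) y =
      (𝓕 b : 𝓢(R3, ℂ)) y := by
  have h1 : b = g + ((2 * Real.pi)⁻¹ ^ 2 : ℝ) • ∑ i,
      (-(2 * Real.pi * Complex.I) • smulLeftCLM ℂ (inner ℝ · (stdVec i))
        (-(2 * Real.pi * Complex.I) • smulLeftCLM ℂ (inner ℝ · (stdVec i)) g)) := by
    ext ξ
    have h2 : ‖ξ‖ ^ 2 = ∑ i, inner ℝ ξ (stdVec i) ^ 2 := by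
      rw [EuclideanSpace.real_norm_sq_eq]
      simp [EuclideanSpace.inner_single_right]
    simp only [add_apply, smul_apply, sum_apply, h,
      SchwartzMap.smulLeftCLM_apply_apply (hasTemperateGrowth_inner_right _), h2,
      Complex.real_smul, smul_eq_mul]
    have h3 (i : Fin 3) : -(2 * Real.pi * Complex.I) * (((inner ℝ ξ (stdVec i) : ℝ) : ℂ) *
        (-(2 * Real.pi * Complex.I) * (((inner ℝ ξ (stdVec i) : ℝ) : ℂ) * g ξ))) =
        -(2 * Real.pi) ^ 2 * (((inner ℝ ξ (stdVec i) ^ 2 : ℝ) : ℂ) * g ξ) := by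
      push_cast
      linear_combination ((2 * Real.pi) ^ 2 * ((inner ℝ ξ (stdVec i) : ℝ) : ℂ) ^ 2 * g ξ : ℂ) *
        Complex.I_sq
    simp only [h3, ← Finset.mul_sum, ← Finset.sum_mul]
    have h4 : (Real.pi : ℂ) ≠ 0 := by exact_mod_cast Real.pi_ne_zero
    push_cast
    field_simp
    ring
  have h5 : (𝓕 b : 𝓢(R3, ℂ)) = 𝓕 g + ((2 * Real.pi)⁻¹ ^ 2 : ℝ) • Δ (𝓕 g) := by
    rw [laplacian_eq_sum_stdVec]
    simp only [SchwartzMap.lineDerivOp_fourier_eq]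
    conv_lhs => rw [h1]
    rw [FourierTransform.fourier_add, FourierTransform.fourier_smul, FourierTransform.fourier_sum]
  rw [h5]
  simp

/-- Complex conjugation of a Schwartz function. -/
def conjSchwartz (f : 𝓢(R3, ℂ)) : 𝓢(R3, ℂ) :=
  SchwartzMap.postcompCLM (𝕜 := ℝ) (Complex.conjCLE : ℂ →L[ℝ] ℂ) f

@[simp] lemma conjSchwartz_apply (f : 𝓢(R3, ℂ)) (x : R3) : conjSchwartz f x = star (f x) := rfl

/-- The reflected conjugate of a kernel `𝓕 b` is again a Fourier transform, so that the two
variables of the forms play symmetric roles. -/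
lemma star_fourier_conjSchwartz_neg (b : 𝓢(R3, ℂ)) (y : R3) :
    star ((𝓕 (conjSchwartz b) : 𝓢(R3, ℂ)) (-y)) = (𝓕 b : 𝓢(R3, ℂ)) y := by
  rw [SchwartzMap.fourier_coe, SchwartzMap.fourier_coe, Real.fourier_eq', Real.fourier_eq',
    RCLike.star_def, ← integral_conj]
  refine integral_congr_ae (.of_forall fun ξ => ?_)
  simp [← Complex.exp_conj, map_ofNat (starRingEnd ℂ)]

lemma pairForm_add_const_mul {δ : ℝ} (hδ : 0 < δ) {u v : R3 → ℂ} (hu : MemLp u 2 volume)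
    (hv : MemLp v 2 volume) (a h₁ h₂ : 𝓢(R3, ℂ)) {h : R3 → ℂ} {k : ℂ}
    (hh : ∀ y, h₁ y + k * h₂ y = h y) :
    pairForm δ u v a h₁ + k * pairForm δ u v a h₂ = pairForm δ u v a h := by
  unfold pairForm
  rw [← integral_const_mul, ← integral_add (integrable_pairForm_schwartz a h₁ hδ hu hv)
    ((integrable_pairForm_schwartz a h₂ hδ hu hv).const_mul k)]
  refine integral_congr_ae (.of_forall fun p => ?_)
  simp only [← hh]
  ring

/-- The family of forms `J(u^ε, v^ε)` at the semiclassical scale is of order `ε ^ s`, on all test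
functions supported away from the unit sphere. -/
def HasOrder (u v : ℝ → R3 → ℂ) (s : ℝ) : Prop :=
  ∀ a b : 𝓢(R3, ℂ), HasCompactSupport a → OffSphere b →
    (fun ε => pairForm (2 * Real.pi * ε) (u ε) (v ε) a (𝓕 b : 𝓢(R3, ℂ))) =O[𝓝[>] (0 : ℝ)]
      fun ε => ε ^ s

lemma rpow_isBigO_rpow {s t : ℝ} (h : t ≤ s) :
    (fun ε : ℝ => ε ^ s) =O[𝓝[>] (0 : ℝ)] fun ε => ε ^ t := by
  refine Asymptotics.IsBigO.of_bound 1 ?_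
  filter_upwards [Ioo_mem_nhdsGT one_pos] with ε hε
  rw [one_mul, Real.norm_of_nonneg (Real.rpow_nonneg hε.1.le _),
    Real.norm_of_nonneg (Real.rpow_nonneg hε.1.le _)]
  exact Real.rpow_le_rpow_of_exponent_ge hε.1 hε.2.le h

lemma HasOrder.mono {u v : ℝ → R3 → ℂ} {s t : ℝ} (h : HasOrder u v s) (hst : t ≤ s) :
    HasOrder u v t :=
  fun a b ha hb => (h a b ha hb).trans (rpow_isBigO_rpow hst)

lemma HasOrder.symm {u v : ℝ → R3 → ℂ} {s : ℝ} (h : HasOrder u v s) : HasOrder v u s := by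
  intro a b ha hb
  have ha' : HasCompactSupport (conjSchwartz a) := ha.comp_left (g := star) (star_zero ℂ)
  have hb' : OffSphere (conjSchwartz b) := hb.mono fun ξ hξ => by simp [hξ]
  refine Asymptotics.IsBigO.of_norm_left ((h _ _ ha' hb').norm_left.congr_left fun ε => ?_)
  rw [← norm_star, star_pairForm]
  simp only [star_fourier_conjSchwartz_neg, conjSchwartz_apply, star_star]

/-- The order of `J(u, v)` in terms of the squared `L²` norms. -/
lemma HasOrder.of_norm_sq {u v : ℝ → R3 → ℂ} {k : ℝ}
    (hu : ∀ ε, 0 < ε → MemLp (u ε) 2 volume) (hv : ∀ ε, 0 < ε → MemLp (v ε) 2 volume)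
    (hu' : (fun ε => ∫ x, ‖u ε x‖ ^ 2) =O[𝓝[>] (0 : ℝ)] fun ε => ε ^ k)
    (hv' : (fun ε => ∫ x, ‖v ε x‖ ^ 2) =O[𝓝[>] (0 : ℝ)] fun ε => ε ^ k) :
    HasOrder u v (3 + k) := by
  intro a b ha hb
  obtain ⟨A, -, hA⟩ := a.decay 0 0
  have hA' : ∀ x, ‖a x‖ ≤ A := fun x => by simpa using hA x
  have h1 : (fun ε : ℝ => ε ^ (3 : ℝ) * ((∫ x, ‖u ε x‖ ^ 2) + ∫ x, ‖v ε x‖ ^ 2)) =O[𝓝[>] (0 : ℝ)]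
      fun ε => ε ^ (3 + k) := by
    refine ((Asymptotics.isBigO_refl _ _).mul (hu'.add hv')).trans_eventuallyEq ?_
    filter_upwards [self_mem_nhdsWithin] with ε hε
    exact (Real.rpow_add hε _ _).symm
  refine Asymptotics.IsBigO.trans (Asymptotics.IsBigO.of_bound
    (A / 2 * ((2 * Real.pi) ^ 3 * ∫ y, ‖(𝓕 b : 𝓢(R3, ℂ)) y‖)) ?_) h1
  filter_upwards [self_mem_nhdsWithin] with ε hε
  rw [Set.mem_Ioi] at hε
  refine (norm_pairForm_le (SchwartzMap.integrable _) hA' (by positivity) (hu ε hε) (hv ε hε)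
    one_pos).trans (le_of_eq ?_)
  have h2 : (0 : ℝ) ≤ ε ^ (3 : ℝ) * ((∫ x, ‖u ε x‖ ^ 2) + ∫ x, ‖v ε x‖ ^ 2) := by
    have : 0 ≤ ∫ x, ‖u ε x‖ ^ 2 := integral_nonneg fun x => by positivity
    have : 0 ≤ ∫ x, ‖v ε x‖ ^ 2 := integral_nonneg fun x => by positivity
    positivity
  rw [Real.norm_of_nonneg h2]
  norm_num
  ring

/-- Ellipticity gains one power of `ε` in `J(u, v)`, as long as the order `r + 2` given by the
source is not reached. -/
lemma HasOrder.gain {α : ℝ → ℝ} (hα : α =O[𝓝[>] (0 : ℝ)] fun _ => (1 : ℝ)) {f u v : ℝ → R3 → ℂ}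
    (hu : ∀ ε, 0 < ε → IsHelmholtzSolution (α ε) ε (f ε) (u ε))
    (hf : ∀ ε, 0 < ε → MemLp (f ε) 2 volume) (hv : ∀ ε, 0 < ε → MemLp (v ε) 2 volume) {r s : ℝ}
    (hfv : HasOrder f v r) (huv : HasOrder u v s) : HasOrder u v (min (s + 1) (r + 2)) := by
  intro a b ha hb
  obtain ⟨g, hg, hbg⟩ := hb.exists_div
  choose g' hg' hgg' using fun i => hg.lineDerivOp_fourier (stdVec i)
  have ha' (m : R3) : HasCompactSupport (∂_{m} a : 𝓢(R3, ℂ)) :=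
    ha.mono' ((subset_tsupport _).trans (SchwartzMap.tsupport_lineDerivOp_subset m a))
  have haΔ : HasCompactSupport (Δ a : 𝓢(R3, ℂ)) := by
    refine ha.mono' fun x hx => ?_
    by_contra hxa
    refine hx ?_
    rw [laplacian_eq_sum_stdVec, sum_apply]
    refine Finset.sum_eq_zero fun i _ => image_eq_zero_of_notMem_tsupport fun h => hxa ?_
    exact SchwartzMap.tsupport_lineDerivOp_subset _ a
      (SchwartzMap.tsupport_lineDerivOp_subset _ _ h)
  -- the Wigner equation with kernel `𝓕 g`, multiplied by `ε ^ 2`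
  have hid : (fun ε : ℝ => (ε : ℝ) ^ 2 * pairForm (2 * Real.pi * ε) (f ε) (v ε) a (𝓕 g : 𝓢(R3, ℂ))
      + Complex.I * α ε * (ε * pairForm (2 * Real.pi * ε) (u ε) (v ε) a (𝓕 g : 𝓢(R3, ℂ)))
      - (2 * Real.pi)⁻¹ * (ε * ∑ i, pairForm (2 * Real.pi * ε) (u ε) (v ε)
          (∂_{stdVec i} a : 𝓢(R3, ℂ)) (𝓕 (g' i) : 𝓢(R3, ℂ)))
      - 1 / 4 * ε * (ε * pairForm (2 * Real.pi * ε) (u ε) (v ε) (Δ a : 𝓢(R3, ℂ))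
          (𝓕 g : 𝓢(R3, ℂ)))) =ᶠ[𝓝[>] (0 : ℝ)]
      fun ε => pairForm (2 * Real.pi * ε) (u ε) (v ε) a (𝓕 b : 𝓢(R3, ℂ)) := by
    filter_upwards [self_mem_nhdsWithin] with ε hε
    rw [Set.mem_Ioi] at hε
    have hδ : 0 < 2 * Real.pi * ε := by positivity
    have h1 := wigner_equation hδ (hu ε hε) (hf ε hε) (hv ε hε) a (𝓕 g) ha
    rw [← pairForm_add_const_mul hδ (hu ε hε).1 (hv ε hε) a (𝓕 g) (Δ (𝓕 g))
      (fourier_add_laplacian hbg), ← h1]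
    simp only [hgg']
    have h2 : (ε : ℂ) ≠ 0 := by exact_mod_cast hε.ne'
    have h4 : (Real.pi : ℂ) ≠ 0 := by exact_mod_cast Real.pi_ne_zero
    push_cast
    field_simp
    ring
  refine Asymptotics.IsBigO.congr' ?_ hid .rfl
  have hcoe : (fun ε : ℝ => (ε : ℂ)) =O[𝓝[>] (0 : ℝ)] fun ε => ε ^ (1 : ℝ) :=
    Asymptotics.IsBigO.of_bound 1 (.of_forall fun ε => by simp)
  have hcoe0 : (fun ε : ℝ => (ε : ℂ)) =O[𝓝[>] (0 : ℝ)] fun ε => (1 : ℝ) :=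
    hcoe.trans (by simpa using rpow_isBigO_rpow (zero_le_one' ℝ))
  have hmul {F : ℝ → ℂ} {s : ℝ} (hF : F =O[𝓝[>] (0 : ℝ)] fun ε => ε ^ s) :
      (fun ε : ℝ => ε * F ε) =O[𝓝[>] (0 : ℝ)] fun ε => ε ^ (s + 1) := by
    refine (hcoe.mul hF).trans_eventuallyEq ?_
    filter_upwards [self_mem_nhdsWithin] with ε hε
    rw [← Real.rpow_add hε, add_comm]
  have hle1 : min (s + 1) (r + 2) ≤ s + 1 := min_le_left _ _
  have hle2 : min (s + 1) (r + 2) ≤ r + 1 + 1 := (min_le_right _ _).trans (by linarith)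
  refine ((Asymptotics.IsBigO.add ?_ ?_).sub ?_).sub ?_
  · refine ((hmul (hmul (hfv a g ha hg))).congr_left fun ε => ?_).trans (rpow_isBigO_rpow hle2)
    ring
  · have h1 : (fun ε => Complex.I * (α ε : ℂ)) =O[𝓝[>] (0 : ℝ)] fun _ => (1 : ℝ) :=
      Asymptotics.IsBigO.of_norm_left (hα.norm_left.congr_left fun ε => by simp)
    simpa using h1.mul ((hmul (huv a g ha hg)).trans (rpow_isBigO_rpow hle1))
  · exact ((hmul (Asymptotics.IsBigO.fun_sum fun i _ => huv _ _ (ha' _) (hg' i))).trans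
      (rpow_isBigO_rpow hle1)).const_mul_left _
  · simpa using (hcoe0.const_mul_left (1 / 4)).mul
      ((hmul (huv _ _ haΔ hg)).trans (rpow_isBigO_rpow hle1))

/-- Elliptic regularity off the unit sphere: a polynomial bound on `J(u, v)` improves to the order
given by the source. -/
lemma HasOrder.of_source {α : ℝ → ℝ} (hα : α =O[𝓝[>] (0 : ℝ)] fun _ => (1 : ℝ))
    {f u v : ℝ → R3 → ℂ} (hu : ∀ ε, 0 < ε → IsHelmholtzSolution (α ε) ε (f ε) (u ε))
    (hf : ∀ ε, 0 < ε → MemLp (f ε) 2 volume) (hv : ∀ ε, 0 < ε → MemLp (v ε) 2 volume) {r s : ℝ}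
    (hfv : HasOrder f v r) (huv : HasOrder u v s) : HasOrder u v (r + 2) := by
  have h (n : ℕ) : HasOrder u v (min (s + n) (r + 2)) := by
    induction n with
    | zero => exact huv.mono (by simp)
    | succ n ih =>
      refine (HasOrder.gain hα hu hf hv hfv ih).mono ?_
      push_cast
      refine le_min ?_ (min_le_right _ _)
      rw [← min_add_add_right]
      exact min_le_min (by linarith) (by linarith)
  obtain ⟨n, hn⟩ := exists_nat_ge (r + 2 - s)
  exact (h n).mono (le_min (by linarith) le_rfl)

/-! ### The sources and the limit -/

lemma MemWeightedL2.memLp {N : ℝ} (hN : 0 ≤ N) {S : R3 → ℂ} (hS : AEStronglyMeasurable S volume)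
    (h : MemWeightedL2 N S) : MemLp S 2 volume := by
  refine MemLp.mono h hS (.of_forall fun x => ?_)
  have h1 : 1 ≤ Real.sqrt (1 + ‖x‖ ^ 2) := Real.one_le_sqrt.2 (by nlinarith [sq_nonneg ‖x‖])
  rw [norm_smul, Real.norm_of_nonneg (by positivity)]
  exact le_mul_of_one_le_left (norm_nonneg _) (Real.one_le_rpow h1 hN)

lemma memLp_rescale {S : R3 → ℂ} (hS : MemLp S 2 volume) {ε : ℝ} (hε : 0 < ε) (q : R3) :
    MemLp (fun x => S (ε⁻¹ • (x - q))) 2 volume := by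
  have h1 : MeasurePreserving (fun y : R3 => ε⁻¹ • y) volume
      (ENNReal.ofReal |(ε⁻¹ ^ 3)⁻¹| • volume) :=
    ⟨measurable_const_smul _, by
      simpa using Measure.map_addHaar_smul (volume : Measure R3) (inv_ne_zero hε.ne')⟩
  exact (hS.smul_measure ENNReal.ofReal_ne_top).comp_measurePreserving
    (h1.comp (measurePreserving_sub_right volume q))

lemma integral_rescale (S : R3 → ℂ) {ε : ℝ} (hε : 0 < ε) (q : R3) :
    ∫ x, ‖S (ε⁻¹ • (x - q))‖ ^ 2 = ε ^ 3 * ∫ x, ‖S x‖ ^ 2 := by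
  rw [integral_sub_right_eq_self (fun x => ‖S (ε⁻¹ • x)‖ ^ 2) q]
  simpa [abs_of_pos hε] using
    Measure.integral_comp_inv_smul (volume : Measure R3) (fun y => ‖S y‖ ^ 2) ε

lemma source_eq (S₀ S₁ : R3 → ℂ) (q : R3) (ε : ℝ) :
    source S₀ S₁ q ε =
      ((ε ^ 3)⁻¹ : ℝ) • fun x => S₀ (ε⁻¹ • (x - 0)) + S₁ (ε⁻¹ • (x - q)) := by
  ext x
  simp [source]

lemma memLp_source {S₀ S₁ : R3 → ℂ} (h₀ : MemLp S₀ 2 volume) (h₁ : MemLp S₁ 2 volume) (q : R3)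
    {ε : ℝ} (hε : 0 < ε) : MemLp (source S₀ S₁ q ε) 2 volume := by
  rw [source_eq]
  exact ((memLp_rescale h₀ hε 0).add (memLp_rescale h₁ hε q)).const_smul _

lemma integral_norm_sq_source_le {S₀ S₁ : R3 → ℂ} (h₀ : MemLp S₀ 2 volume)
    (h₁ : MemLp S₁ 2 volume) (q : R3) {ε : ℝ} (hε : 0 < ε) :
    ∫ x, ‖source S₀ S₁ q ε x‖ ^ 2 ≤
      2 * ((∫ x, ‖S₀ x‖ ^ 2) + ∫ x, ‖S₁ x‖ ^ 2) * (ε ^ 3)⁻¹ := by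
  have i0 := integrable_sq_norm (memLp_rescale h₀ hε 0)
  have i1 := integrable_sq_norm (memLp_rescale h₁ hε q)
  calc ∫ x, ‖source S₀ S₁ q ε x‖ ^ 2
      ≤ ∫ x, 2 * ((ε ^ 3)⁻¹) ^ 2 * (‖S₀ (ε⁻¹ • (x - 0))‖ ^ 2 + ‖S₁ (ε⁻¹ • (x - q))‖ ^ 2) := by
        refine integral_mono (integrable_sq_norm (memLp_source h₀ h₁ q hε))
          ((i0.fun_add i1).const_mul _) fun x => ?_
        rw [source_eq]
        simp only [Pi.smul_apply, norm_smul, mul_pow]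
        rw [Real.norm_of_nonneg (by positivity), mul_comm 2, mul_assoc]
        gcongr
        have h2 := norm_add_le (S₀ (ε⁻¹ • (x - 0))) (S₁ (ε⁻¹ • (x - q)))
        have h3 := pow_le_pow_left₀ (norm_nonneg _) h2 2
        nlinarith [sq_nonneg (‖S₀ (ε⁻¹ • (x - 0))‖ - ‖S₁ (ε⁻¹ • (x - q))‖)]
    _ = _ := by
        rw [integral_const_mul, integral_add i0 i1, integral_rescale S₀ hε, integral_rescale S₁ hε]
        field_simp

/-- A locally finite measure does not charge a neighbourhood of `p` if it annihilates the tensor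
products of test functions whose second factor is supported away from the unit sphere. -/
lemma notMem_support_of_integral_eq_zero {μ : Measure (R3 × R3)} [IsLocallyFiniteMeasure μ]
    (h : ∀ a b : 𝓢(R3, ℂ), HasCompactSupport a → OffSphere b → ∫ p, a p.1 * b p.2 ∂μ = 0)
    {p : R3 × R3} (hp : ‖p.2‖ ^ 2 ≠ 1) : p ∉ μ.support := by
  have hopen : IsOpen {ξ : R3 | ‖ξ‖ ^ 2 ≠ 1} :=
    isOpen_ne_fun (by fun_prop) continuous_const
  obtain ⟨r, hr, hball⟩ := Metric.isOpen_iff.1 hopen p.2 hp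
  let A : ContDiffBump p.1 := ⟨1, 2, one_pos, one_lt_two⟩
  let B : ContDiffBump p.2 := ⟨r / 4, r / 2, by positivity, by linarith⟩
  have hB : OffSphere (ofRealSchwartz B B.hasCompactSupport B.contDiff) := by
    refine ⟨hasCompactSupport_ofRealSchwartz _ _ _, fun ξ hξ => ?_⟩
    have h1 : ξ ∈ tsupport B := tsupport_ofRealSchwartz_subset _ _ _ hξ
    rw [B.tsupport_eq] at h1
    exact hball (Metric.closedBall_subset_ball (half_lt_self hr) h1)
  have h1 := h _ _ (hasCompactSupport_ofRealSchwartz _ A.hasCompactSupport A.contDiff) hB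
  have hcont : Continuous fun q : R3 × R3 => A q.1 * B q.2 :=
    (A.continuous.comp continuous_fst).mul (B.continuous.comp continuous_snd)
  have hsupp : HasCompactSupport fun q : R3 × R3 => A q.1 * B q.2 := by
    refine HasCompactSupport.intro (A.hasCompactSupport.isCompact.prod B.hasCompactSupport.isCompact)
      fun q hq => ?_
    by_cases hq1 : q.1 ∈ tsupport A
    · have hq2 : q.2 ∉ tsupport B := fun h => hq ⟨hq1, h⟩
      simp [image_eq_zero_of_notMem_tsupport hq2]
    · simp [image_eq_zero_of_notMem_tsupport hq1]
  have h2 : ∫ q : R3 × R3, A q.1 * B q.2 ∂μ = 0 := by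
    simp only [ofRealSchwartz_apply, ← Complex.ofReal_mul, integral_complex_ofReal] at h1
    exact_mod_cast h1
  rw [integral_eq_zero_iff_of_nonneg (fun q => mul_nonneg A.nonneg B.nonneg)
    (hcont.integrable_of_hasCompactSupport hsupp)] at h2
  rw [Measure.notMem_support_iff_exists]
  refine ⟨{q | A q.1 * B q.2 ≠ 0}, ?_, h2⟩
  refine (isOpen_ne_fun hcont continuous_const).mem_nhds ?_
  have hA1 : A p.1 = 1 := A.one_of_mem_closedBall (Metric.mem_closedBall_self A.rIn_pos.le)
  have hB1 : B p.2 = 1 := B.one_of_mem_closedBall (Metric.mem_closedBall_self B.rIn_pos.le)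
  simp [hA1, hB1]

/-- The Wigner transforms of the solutions vanish, as `ε → 0`, when tested away from the unit
sphere. -/
lemma tendsto_integral_wigner {α : ℝ → ℝ} (hα_pos : ∀ ε, 0 < ε → 0 < α ε)
    (hα_lim : Tendsto α (𝓝[>] (0 : ℝ)) (𝓝 0)) {γ : ℝ} (hγ : 0 < γ)
    (hα : ∀ᶠ ε : ℝ in 𝓝[>] (0 : ℝ), ε ^ γ ≤ α ε) {S₀ S₁ : R3 → ℂ} (h₀ : MemLp S₀ 2 volume)
    (h₁ : MemLp S₁ 2 volume) {q : R3} {u : ℝ → R3 → ℂ}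
    (hu : ∀ ε, 0 < ε → IsHelmholtzSolution (α ε) ε (source S₀ S₁ q ε) (u ε))
    {a b : 𝓢(R3, ℂ)} (ha : HasCompactSupport a) (hb : OffSphere b) :
    Tendsto (fun ε => ∫ p, wigner ε (u ε) p * (a p.1 * b p.2)) (𝓝[>] (0 : ℝ)) (𝓝 0) := by
  set f : ℝ → R3 → ℂ := source S₀ S₁ q
  have hf (ε : ℝ) (hε : 0 < ε) : MemLp (f ε) 2 volume := memLp_source h₀ h₁ q hε
  have hα1 : α =O[𝓝[>] (0 : ℝ)] fun _ => (1 : ℝ) := hα_lim.isBigO_one ℝ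
  have hfO : (fun ε => ∫ x, ‖f ε x‖ ^ 2) =O[𝓝[>] (0 : ℝ)] fun ε => ε ^ (-3 : ℝ) := by
    refine Asymptotics.IsBigO.of_bound (2 * ((∫ x, ‖S₀ x‖ ^ 2) + ∫ x, ‖S₁ x‖ ^ 2)) ?_
    filter_upwards [self_mem_nhdsWithin] with ε hε
    rw [Real.norm_of_nonneg (integral_nonneg fun x => by positivity), Real.rpow_neg (le_of_lt hε),
      Real.norm_of_nonneg (inv_nonneg.2 (Real.rpow_nonneg (le_of_lt hε) _))]
    simpa using integral_norm_sq_source_le h₀ h₁ q hε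
  have huO : (fun ε => ∫ x, ‖u ε x‖ ^ 2) =O[𝓝[>] (0 : ℝ)] fun ε => ε ^ (-3 - 2 * γ) := by
    have h1 : (fun ε => ∫ x, ‖u ε x‖ ^ 2) =O[𝓝[>] (0 : ℝ)]
        fun ε => ε ^ (-2 * γ) * ∫ x, ‖f ε x‖ ^ 2 := by
      refine Asymptotics.IsBigO.of_bound 1 ?_
      filter_upwards [Ioo_mem_nhdsGT one_pos, hα] with ε hε hαε
      have hp : 0 < ε ^ γ := Real.rpow_pos_of_pos hε.1 _
      have hF : 0 ≤ ∫ x, ‖f ε x‖ ^ 2 := integral_nonneg fun x => by positivity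
      rw [Real.norm_of_nonneg (integral_nonneg fun x => by positivity), Real.norm_of_nonneg
        (mul_nonneg (Real.rpow_nonneg hε.1.le _) hF), one_mul]
      refine (energy_estimate (hα_pos ε hε.1) hε.1 (hu ε hε.1) (hf ε hε.1)).trans ?_
      have h2 : ε ^ (-2 * γ) = (1 / ε ^ γ) ^ 2 := by
        rw [one_div, ← Real.rpow_neg hε.1.le, ← Real.rpow_natCast, ← Real.rpow_mul hε.1.le]
        congr 1
        push_cast
        ring
      have h3 : ε / α ε ≤ 1 / ε ^ γ := div_le_div₀ zero_le_one hε.2.le hp hαε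
      have h4 : 0 ≤ ε / α ε := div_nonneg hε.1.le (hα_pos ε hε.1).le
      rw [h2]
      gcongr
    refine (h1.trans ((Asymptotics.isBigO_refl _ _).mul hfO)).trans_eventuallyEq ?_
    filter_upwards [self_mem_nhdsWithin] with ε hε
    rw [← Real.rpow_add hε]
    congr 1
    ring
  have hfO' := hfO.trans (rpow_isBigO_rpow (show -3 - 2 * γ ≤ -3 by linarith))
  have hum (ε : ℝ) (hε : 0 < ε) : MemLp (u ε) 2 volume := (hu ε hε).1
  -- `J(f, f) = O(1)`, hence `J(u, f) = O(ε²)`, hence `J(u, u) = O(ε⁴)`.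
  have hff : HasOrder f f 0 := (HasOrder.of_norm_sq hf hf hfO hfO).mono (by norm_num)
  have huf : HasOrder u f (0 + 2) :=
    HasOrder.of_source hα1 hu hf hf hff (HasOrder.of_norm_sq hum hf huO hfO')
  have huu : HasOrder u u (0 + 2 + 2) :=
    HasOrder.of_source hα1 hu hf hum huf.symm (HasOrder.of_norm_sq hum hum huO huO)
  have h4 := huu a b ha hb
  have h5 : (fun ε => ∫ p, wigner ε (u ε) p * (a p.1 * b p.2)) =O[𝓝[>] (0 : ℝ)]
      fun ε => ε := by
    have h6 : (fun ε : ℝ => (((2 * Real.pi) ^ 3)⁻¹ * (ε ^ 3)⁻¹ : ℝ)) =O[𝓝[>] (0 : ℝ)]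
        fun ε => (ε ^ 3)⁻¹ := (Asymptotics.isBigO_refl _ _).const_mul_left _
    refine (h6.smul h4).congr' ?_ ?_
    · filter_upwards [self_mem_nhdsWithin] with ε hε
      exact (integral_wigner_mul hε (hum ε hε) a b).symm
    · filter_upwards [self_mem_nhdsWithin] with ε hε
      have h7 : (ε : ℝ) ≠ 0 := (Set.mem_Ioi.1 hε).ne'
      have h8 : ε ^ (0 + 2 + 2 : ℝ) = ε ^ 4 := by
        rw [← Real.rpow_natCast]
        norm_num
      rw [h8, smul_eq_mul]
      field_simp
  exact h5.trans_tendsto (tendsto_nhdsWithin_of_tendsto_nhds tendsto_id)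

end HelmholtzWigner

end

theorem proposition4p4
    (S₀ S₁ : HelmholtzWigner.R3 → ℂ) (q₁ : HelmholtzWigner.R3) (hq₁ : q₁ ≠ 0)
    (α : ℝ → ℝ) (hα_pos : ∀ ε : ℝ, 0 < ε → 0 < α ε)
    (hα_lim : Tendsto α (𝓝[>] (0 : ℝ)) (𝓝 0))
    (γ : ℝ) (hγ : 0 < γ) (H1 : ∀ᶠ ε : ℝ in 𝓝[>] (0 : ℝ), ε ^ γ ≤ α ε)
    (H2 : HelmholtzWigner.MemB S₀ ∧ HelmholtzWigner.MemB S₁)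
    (N : ℝ) (hN : 1 / 2 + 3 * γ / (γ + 1) < N)
    (H3 : HelmholtzWigner.MemWeightedL2 N S₀ ∧ HelmholtzWigner.MemWeightedL2 N S₁)
    (u : ℝ → HelmholtzWigner.R3 → ℂ)
    (hu : ∀ ε : ℝ, 0 < ε →
      HelmholtzWigner.IsHelmholtzSolution (α ε) ε (HelmholtzWigner.source S₀ S₁ q₁ ε) (u ε))
    (μ : Measure (HelmholtzWigner.R3 × HelmholtzWigner.R3))
    (hμ : HelmholtzWigner.IsWignerMeasure u μ) :
    μ.support ⊆ {p : HelmholtzWigner.R3 × HelmholtzWigner.R3 | ‖p.2‖ ^ 2 = 1} := by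
  obtain ⟨hfin, e, he_pos, he_lim, hlim⟩ := hμ
  have hN0 : 0 ≤ N := by
    have : 0 ≤ 3 * γ / (γ + 1) := by positivity
    linarith
  have h₀ := H3.1.memLp hN0 H2.1.1
  have h₁ := H3.2.memLp hN0 H2.2.1
  have he : Tendsto e atTop (𝓝[>] (0 : ℝ)) :=
    tendsto_nhdsWithin_iff.2 ⟨he_lim, .of_forall he_pos⟩
  intro p hp
  by_contra hpn
  refine HelmholtzWigner.notMem_support_of_integral_eq_zero (fun a b ha hb => ?_) hpn hp
  refine tendsto_nhds_unique (hlim (fun p => a p.1 * b p.2)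
    (((a.smooth ⊤).comp contDiff_fst).mul ((b.smooth ⊤).comp contDiff_snd)) ?_)
    ((HelmholtzWigner.tendsto_integral_wigner hα_pos hα_lim hγ H1 h₀ h₁ hu ha hb).comp he)
  refine HasCompactSupport.intro (ha.isCompact.prod hb.1.isCompact) fun q hq => ?_
  by_cases hq1 : q.1 ∈ tsupport a
  · have hq2 : q.2 ∉ tsupport b := fun h => hq ⟨hq1, h⟩
    simp [image_eq_zero_of_notMem_tsupport hq2]
  · simp [image_eq_zero_of_notMem_tsupport hq1]
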